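/- Let $G=(V,E,w,m)$ be an infinite weighted graph: a locally finite, undirected, simple graph with infinite vertex set $V$, edge set $E$, positive edge weights $w:E\to(0,\infty)$ (write $w(x,y)=w(\{x,y\})$ if $x\sim y$ and $w(x,y)=0$ otherwise) and positive vertex weights $m:V\to(0,\infty)$. Its Laplacian is $$\Delta f(x)=\frac1{m(x)}\sum_{y\sim x}w(x,y)\,(f(y)-f(x)),$$ and the bottom of the spectrum of the Laplacian is $$\lambda_1(G)=\inf_{\substack{H\subseteq l_0(V)\\ \dim H=1}}\ \max_{0\ne f\in H}\frac{\mathcal E(f,f)}{\|f\|_{l^2(V)}^2},\qquad \mathcal E(f,f)=\frac12\sum_{x,y\in V}w(x,y)\,(f(y)-f(x))^2,\qquad \|f\|_{l^2(V)}^2=\sum_{x\in V}f(x)^2m(x),$$ where $l_0(V)$ is the space of finitely supported functions $V\to\mathbb R$. The graph $G$ is called recurrent if, for every vertex $x$, the random walk on $G$ with transition probabilities $$p(x,y)=\frac{w(x,y)}{\sum_{z\sim x}w(x,z)}$$ (staying put at a vertex without neighbours) started at $x$ almost surely returns to $x$ at some time $n\ge1$. For a connected graph this is the usual recurrence of the random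 walk. **Proposition.** If $G$ is recurrent, then $\lambda_1(G)=0$. -/

import Mathlib

open MeasureTheory ProbabilityTheory
open scoped ENNReal

noncomputable section

/-- A weighted graph `G = (V, E, w, m)`: a locally finite simple graph on `V` with symmetric
positive edge weights `w`, extended by `0` to non-adjacent pairs, and positive vertex
weights `m`. -/
structure WeightedGraph (V : Type*) where
  graph : SimpleGraph V
  locallyFinite : ∀ x, (graph.neighborSet x).Finite
  w : V → V → ℝ
  w_symm : ∀ x y, w x y = w y x
  w_pos : ∀ x y, graph.Adj x y → 0 < w x y
  w_eq_zero : ∀ x y, ¬ graph.Adj x y → w x y = 0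
  m : V → ℝ
  m_pos : ∀ x, 0 < m x

namespace WeightedGraph

variable {V : Type*} (G : WeightedGraph V)

lemma w_nonneg (x y : V) : 0 ≤ G.w x y := by
  by_cases h : G.graph.Adj x y
  · exact (G.w_pos x y h).le
  · exact (G.w_eq_zero x y h).ge

/-- The finite set of neighbours of `x`. -/
def nbrs (x : V) : Finset V := (G.locallyFinite x).toFinset

lemma mem_nbrs (x y : V) : y ∈ G.nbrs x ↔ G.graph.Adj x y := by
  simp [nbrs]

/-! ### The variational eigenvalues of the Laplacian -/

/-- The energy `𝓔(f, g) = ½ ∑_{x, y} w(x, y) (f(y) - f(x)) (g(y) - g(x))`. -/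
def energy (f g : V → ℝ) : ℝ :=
  (1 / 2) * ∑' p : V × V, G.w p.1 p.2 * (f p.2 - f p.1) * (g p.2 - g p.1)

/-- The energy sum converges absolutely (it has finitely many nonzero terms) for finitely
supported functions. -/
lemma summable_energy (f g : V →₀ ℝ) :
    Summable fun p : V × V => G.w p.1 p.2 * (f p.2 - f p.1) * (g p.2 - g p.1) := by
  classical
  apply summable_of_hasFiniteSupport
  refine ((f.support.biUnion fun x =>
    (G.nbrs x).image (fun y => (x, y)) ∪
      (G.nbrs x).image (fun y => (y, x))).finite_toSet).subset ?_
  rintro ⟨x, y⟩ h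
  have hw : G.graph.Adj x y := by
    by_contra hn
    exact h (by simp [G.w_eq_zero x y hn])
  have hf : f x ≠ 0 ∨ f y ≠ 0 := by
    by_contra hn
    push Not at hn
    exact h (by simp [hn.1, hn.2])
  simp only [Finset.coe_biUnion, Set.mem_iUnion, Finset.mem_coe, Finset.mem_union,
    Finset.mem_image, Finsupp.mem_support_iff, mem_nbrs, Prod.mk.injEq]
  rcases hf with hf | hf
  · exact ⟨x, hf, Or.inl ⟨y, hw, rfl, rfl⟩⟩
  · exact ⟨y, hf, Or.inr ⟨x, hw.symm, rfl, rfl⟩⟩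

/-- The squared norm `‖f‖² = ∑_x f(x)² m(x)` of `l²(V, m)`. -/
def normSq (f : V → ℝ) : ℝ := ∑' x, f x ^ 2 * G.m x

/-- The `k`-th variational eigenvalue (`k ≥ 1`) of the Laplacian of `G`: the infimum over all
`k`-dimensional spaces `H` of finitely supported functions of the maximum over `0 ≠ f ∈ H` of the
Rayleigh quotient `𝓔(f, f) / ‖f‖²`. Infimum and supremum are taken in the extended reals. -/
def variationalEigenvalue (k : ℕ) : EReal :=
  ⨅ (H : Submodule ℝ (V →₀ ℝ)) (_ : Module.finrank ℝ H = k),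
    ⨆ (f : V →₀ ℝ) (_ : f ∈ H) (_ : f ≠ 0), ((G.energy f f / G.normSq f : ℝ) : EReal)

/-- The bottom `λ₁(G)` of the spectrum of the Laplacian of `G`. -/
def bottomOfSpectrum : EReal := G.variationalEigenvalue 1

/-! ### The random walk and recurrence -/

/-- The total edge weight `∑_{y ∼ x} w(x, y)` at `x`. -/
def totalWeight (x : V) : ℝ := ∑ y ∈ G.nbrs x, G.w x y

lemma totalWeight_nonneg (x : V) : 0 ≤ G.totalWeight x :=
  Finset.sum_nonneg fun y _ => G.w_nonneg x y

open Classical in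
/-- The transition probabilities `p(x, y) = w(x, y) / ∑_{z ∼ x} w(x, z)` of the random walk
on `G`. (At a vertex without neighbours the walk stays where it is.) -/
def transProb (x y : V) : ℝ :=
  if G.totalWeight x = 0 then (if y = x then 1 else 0) else G.w x y / G.totalWeight x

lemma transProb_nonneg (x y : V) : 0 ≤ G.transProb x y := by
  unfold transProb
  split_ifs
  · exact zero_le_one
  · exact le_rfl
  · exact div_nonneg (G.w_nonneg x y) (G.totalWeight_nonneg x)

lemma hasSum_transProb (x : V) : HasSum (G.transProb x) 1 := by
  classical
  by_cases h : G.totalWeight x = 0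
  · have : G.transProb x = fun y => if y = x then 1 else 0 := by
      funext y; simp [transProb, h]
    rw [this]
    exact hasSum_ite_eq x 1
  · have h1 : ∑ y ∈ G.nbrs x, G.transProb x y = 1 := by
      simp only [transProb, if_neg h, ← Finset.sum_div]
      exact div_self h
    rw [← h1]
    refine hasSum_sum_of_ne_finset_zero fun y hy => ?_
    rw [mem_nbrs] at hy
    simp [transProb, h, G.w_eq_zero x y hy]

/-- The distribution `p(x, ·)` of one step of the random walk from `x`. -/
def stepPMF (x : V) : PMF V :=
  ⟨fun y => ENNReal.ofReal (G.transProb x y), by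
    have h := ENNReal.ofReal_tsum_of_nonneg (G.transProb_nonneg x) (G.hasSum_transProb x).summable
    rw [(G.hasSum_transProb x).tsum_eq, ENNReal.ofReal_one] at h
    rw [h]
    exact ENNReal.summable.hasSum⟩

section Walk

variable [MeasurableSpace V] [DiscreteMeasurableSpace V]

/-- The transition kernel of the random walk. -/
def stepKernel : Kernel V V where
  toFun x := (G.stepPMF x).toMeasure
  measurable' := Measurable.of_discrete

instance : IsMarkovKernel G.stepKernel :=
  ⟨fun x => PMF.toMeasure.isProbabilityMeasure (G.stepPMF x)⟩

/-- The law of the next position given the positions at times `0, …, n`: it depends only on the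
position at time `n`. -/
def historyKernel (n : ℕ) : Kernel (Finset.Iic n → V) V :=
  G.stepKernel.comap (fun h => h ⟨n, Finset.mem_Iic.2 le_rfl⟩) (measurable_pi_apply _)

instance (n : ℕ) : IsMarkovKernel (G.historyKernel n) := by
  unfold historyKernel; infer_instance

/-- The law on the path space `V^ℕ` of the random walk `(ω 0, ω 1, …)` on `G` started at `x`. -/
def walkLaw (x : V) : Measure (ℕ → V) :=
  Kernel.traj (X := fun _ => V) G.historyKernel 0 (fun _ => x)

end Walk

/-- `G` is recurrent: from every vertex `x`, the random walk started at `x` almost surely returns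
to `x`. (Vertices carry the discrete `σ`-algebra.) -/
def IsRecurrent : Prop :=
  letI : MeasurableSpace V := ⊤
  haveI : DiscreteMeasurableSpace V := ⟨fun _ => trivial⟩
  ∀ x : V, ∀ᵐ ω ∂(G.walkLaw x), ∃ n : ℕ, 1 ≤ n ∧ ω n = x

end WeightedGraph

end

noncomputable section

open Filter Topology Finset

namespace WeightedGraph

variable {V : Type*} (G : WeightedGraph V)

/-! Fix a vertex `x`, let P be the transition operator, π the total weight, and test the Rayleigh
quotient on g = ∑_{k<n} P^k δ_x. Since g - P g = δ_x - P^n δ_x, Green's formula gives 𝓔(g, g) ≤ π(x)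
g(x) (`energy_greenFun_le`), while ‖g‖² ≥ g(x)² m(x). So λ₁ ≤ π(x) / (m(x) g(x)), and it suffices
that g(x) → ∞ as n grows. Let s_k be the probability of no return up to time k. Sorting paths by
their last visit to `x` yields n ≤ g(x) ∑_{k<n} s_k (`le_greenFun_mul_sum_survival`), so 1/g(x) is
at most a Cesàro mean of s. Recurrence says s_k → 0 (`tendsto_survival`), hence so do the means. -/

/-! ### The transition operator -/

open Classical in
/-- The vertices the random walk can reach in one step from `x` (and `x` itself). -/
def stepSet (x : V) : Finset V := insert x (G.nbrs x)

lemma transProb_eq_zero {x y : V} (h : y ∉ G.stepSet x) : G.transProb x y = 0 := by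
  classical
  simp only [stepSet, Finset.mem_insert, mem_nbrs, not_or] at h
  unfold transProb
  simp [h.1, G.w_eq_zero x y h.2]

lemma sum_transProb (x : V) : ∑ y ∈ G.stepSet x, G.transProb x y = 1 :=
  (hasSum_sum_of_ne_finset_zero fun _ h => G.transProb_eq_zero h).unique (G.hasSum_transProb x)

/-- The transition operator `P f(x) = ∑_y p(x, y) f(y)` of the random walk. -/
def markovOp : (V → ℝ) →ₗ[ℝ] (V → ℝ) where
  toFun f x := ∑ y ∈ G.stepSet x, G.transProb x y * f y
  map_add' f g := by ext x; simp [mul_add, Finset.sum_add_distrib]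
  map_smul' c f := by ext x; simp [Finset.mul_sum, mul_left_comm]

lemma markovOp_apply (f : V → ℝ) (x : V) :
    G.markovOp f x = ∑ y ∈ G.stepSet x, G.transProb x y * f y := rfl

lemma markovOp_one : G.markovOp 1 = 1 := by
  ext x; simp [markovOp_apply, sum_transProb]

lemma markovOp_nonneg {f : V → ℝ} (hf : 0 ≤ f) : 0 ≤ G.markovOp f := fun x =>
  Finset.sum_nonneg fun y _ => mul_nonneg (G.transProb_nonneg x y) (hf y)

lemma markovOp_pow_nonneg {f : V → ℝ} (hf : 0 ≤ f) (n : ℕ) : 0 ≤ (G.markovOp ^ n) f := by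
  induction n with
  | zero => simpa using hf
  | succ n ih =>
    rw [pow_succ', Module.End.mul_apply]
    exact G.markovOp_nonneg ih

lemma w_eq_zero_of_totalWeight {x : V} (h : G.totalWeight x = 0) (y : V) : G.w x y = 0 := by
  by_cases hy : G.graph.Adj x y
  · exact (Finset.sum_eq_zero_iff_of_nonneg fun z _ => G.w_nonneg x z).1 h y ((G.mem_nbrs x y).2 hy)
  · exact G.w_eq_zero x y hy

lemma totalWeight_mul_transProb {x y : V} (hxy : G.totalWeight x ≠ 0) :
    G.totalWeight x * G.transProb x y = G.w x y := by
  rw [transProb, if_neg hxy, mul_div_cancel₀ _ hxy]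

lemma sum_w_eq_totalWeight {x : V} {S : Finset V} (hS : G.nbrs x ⊆ S) :
    ∑ y ∈ S, G.w x y = G.totalWeight x :=
  (Finset.sum_subset hS fun y _ hy => G.w_eq_zero x y (by rwa [mem_nbrs] at hy)).symm

/-- With the denominator cleared, isolated vertices need no exception: both sides vanish there. -/
lemma totalWeight_mul_markovOp (f : V → ℝ) {x : V} {S : Finset V} (hS : G.nbrs x ⊆ S) :
    G.totalWeight x * G.markovOp f x = ∑ y ∈ S, G.w x y * f y := by
  classical
  by_cases h : G.totalWeight x = 0
  · simp [h, G.w_eq_zero_of_totalWeight h]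
  · rw [← Finset.sum_subset hS fun y _ hy => by
      rw [G.w_eq_zero x y (by rwa [mem_nbrs] at hy), zero_mul]]
    rw [Finset.sum_subset (Finset.subset_insert x (G.nbrs x)) fun y _ hy => by
      rw [G.w_eq_zero x y (by rwa [mem_nbrs] at hy), zero_mul]]
    rw [markovOp_apply, Finset.mul_sum]
    exact Finset.sum_congr rfl fun y _ => by rw [← mul_assoc, G.totalWeight_mul_transProb h]

lemma finite_support_markovOp {f : V → ℝ} (hf : f.support.Finite) :
    (G.markovOp f).support.Finite := by
  classical
  refine ((hf.toFinset.biUnion G.stepSet).finite_toSet).subset fun x hx => ?_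
  obtain ⟨y, hy, hne⟩ := Finset.exists_ne_zero_of_sum_ne_zero hx
  refine Finset.mem_coe.2 (Finset.mem_biUnion.2 ⟨y, by simpa using right_ne_zero_of_mul hne, ?_⟩)
  simp only [stepSet, Finset.mem_insert, mem_nbrs] at hy ⊢
  exact hy.imp Eq.symm SimpleGraph.Adj.symm

lemma finite_support_markovOp_pow {f : V → ℝ} (hf : f.support.Finite) (n : ℕ) :
    ((G.markovOp ^ n) f).support.Finite := by
  induction n with
  | zero => simpa using hf
  | succ n ih =>
    rw [pow_succ', Module.End.mul_apply]
    exact G.finite_support_markovOp ih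

/-! ### Green's formula -/

lemma energy_nonneg (f : V → ℝ) : 0 ≤ G.energy f f := by
  refine mul_nonneg (by norm_num) (tsum_nonneg fun p => ?_)
  rw [mul_assoc]
  exact mul_nonneg (G.w_nonneg _ _) (mul_self_nonneg _)

lemma energy_smul (c : ℝ) (f : V → ℝ) : G.energy (c • f) (c • f) = c ^ 2 * G.energy f f := by
  unfold energy
  simp only [← tsum_mul_left]
  refine tsum_congr fun p => ?_
  simp only [Pi.smul_apply, smul_eq_mul]
  ring

lemma normSq_nonneg (f : V → ℝ) : 0 ≤ G.normSq f :=
  tsum_nonneg fun x => mul_nonneg (sq_nonneg _) (G.m_pos x).le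

lemma normSq_smul (c : ℝ) (f : V → ℝ) : G.normSq (c • f) = c ^ 2 * G.normSq f := by
  unfold normSq
  rw [← tsum_mul_left]
  congr 1
  ext p
  simp only [Pi.smul_apply, smul_eq_mul]
  ring

lemma sq_mul_le_normSq (f : V →₀ ℝ) (x : V) : f x ^ 2 * G.m x ≤ G.normSq f := by
  have hs : Summable fun y => f y ^ 2 * G.m y := by
    refine summable_of_hasFiniteSupport (f.support.finite_toSet.subset fun y hy => ?_)
    simp only [Finset.mem_coe, Finsupp.mem_support_iff]
    rintro h
    exact hy (by simp [h])
  exact hs.le_tsum x fun y _ => mul_nonneg (sq_nonneg _) (G.m_pos y).le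

/-- Green's formula `𝓔(f, f) = ∑_x π(x) f(x) (f - P f)(x)`, where `π` is the total weight. -/
lemma energy_eq_sum (f : V →₀ ℝ) :
    G.energy f f = ∑ x ∈ f.support, G.totalWeight x * f x * (f x - G.markovOp f x) := by
  classical
  -- `S` contains both ends of every edge that meets the support, so the energy is a sum over `S ×
  -- S`.
  set S : Finset V := f.support ∪ f.support.biUnion G.nbrs with hSdef
  have hsub : f.support ⊆ S := Finset.subset_union_left
  have hnb : ∀ x ∈ f.support, G.nbrs x ⊆ S := fun x hx =>
    (Finset.subset_biUnion_of_mem G.nbrs hx).trans Finset.subset_union_right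
  have hmem : ∀ x y, G.graph.Adj x y → f x ≠ 0 → x ∈ S ∧ y ∈ S := fun x y hxy hx =>
    ⟨hsub (by simpa using hx), hnb x (by simpa using hx) ((G.mem_nbrs x y).2 hxy)⟩
  have h1 : G.energy f f = 1 / 2 * ∑ x ∈ S, ∑ y ∈ S, G.w x y * (f y - f x) * (f y - f x) := by
    unfold energy
    rw [← Finset.sum_product', tsum_eq_sum]
    rintro ⟨x, y⟩ hxy
    by_contra hne
    have hadj : G.graph.Adj x y := by
      by_contra hn
      exact hne (by simp [G.w_eq_zero x y hn])
    have hf : f x ≠ 0 ∨ f y ≠ 0 := by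
      by_contra hn
      push Not at hn
      exact hne (by simp [hn.1, hn.2])
    rcases hf with hf | hf
    · exact hxy (Finset.mem_product.2 (hmem x y hadj hf))
    · exact hxy (Finset.mem_product.2 (hmem y x hadj.symm hf).symm)
  have h2 : ∑ x ∈ S, ∑ y ∈ S, G.w x y * (f y * f y - f x * f y) =
      ∑ x ∈ S, ∑ y ∈ S, G.w x y * (f x * f x - f x * f y) := by
    rw [Finset.sum_comm]
    refine Finset.sum_congr rfl fun x _ => Finset.sum_congr rfl fun y _ => ?_
    rw [G.w_symm y x, mul_comm (f y) (f x)]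
  have h3 : G.energy f f = ∑ x ∈ S, ∑ y ∈ S, G.w x y * (f x * f x - f x * f y) := by
    have : ∀ x y, G.w x y * (f y - f x) * (f y - f x) =
      G.w x y * (f y * f y - f x * f y) + G.w x y * (f x * f x - f x * f y) := fun x y => by ring
    simp only [h1, this, Finset.sum_add_distrib, h2]
    ring
  rw [h3, ← Finset.sum_subset hsub fun x _ hx => by
    rw [Finsupp.notMem_support_iff] at hx
    simp [hx]]
  refine Finset.sum_congr rfl fun x hx => ?_
  have h4 := G.totalWeight_mul_markovOp f (hnb x hx)
  calc ∑ y ∈ S, G.w x y * (f x * f x - f x * f y)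
      = (∑ y ∈ S, G.w x y) * (f x * f x) - f x * ∑ y ∈ S, G.w x y * f y := by
        rw [Finset.sum_mul, Finset.mul_sum, ← Finset.sum_sub_distrib]
        exact Finset.sum_congr rfl fun y _ => by ring
    _ = _ := by
        rw [← h4, G.sum_w_eq_totalWeight (hnb x hx)]
        ring

/-! ### Truncated Green functions -/

open Classical in
/-- The truncated Green function `∑_{k < n} P^k δ_x`. -/
def greenFun (x : V) (n : ℕ) : V →₀ ℝ :=
  Finsupp.ofSupportFinite (∑ k ∈ range n, (G.markovOp ^ k) (Pi.single x 1)) <| by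
    refine ((Set.finite_iUnion fun k : range n => G.finite_support_markovOp_pow
      (f := Pi.single x 1) ((Set.finite_singleton x).subset Pi.support_single_subset) k)).subset
        fun y hy => ?_
    simp only [Function.mem_support, Finset.sum_apply] at hy
    obtain ⟨k, hk, hne⟩ := Finset.exists_ne_zero_of_sum_ne_zero hy
    exact Set.mem_iUnion.2 ⟨⟨k, hk⟩, hne⟩

open Classical in
lemma coe_greenFun (x : V) (n : ℕ) :
    ⇑(G.greenFun x n) = ∑ k ∈ range n, (G.markovOp ^ k) (Pi.single x 1) := rfl

open Classical in
lemma single_nonneg (x : V) : (0 : V → ℝ) ≤ Pi.single x 1 :=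
  Pi.single_nonneg.2 zero_le_one

lemma greenFun_nonneg (x : V) (n : ℕ) (y : V) : 0 ≤ G.greenFun x n y := by
  classical
  rw [coe_greenFun, Finset.sum_apply]
  exact Finset.sum_nonneg fun k _ => G.markovOp_pow_nonneg (single_nonneg x) k y

-- The sum telescopes.
open Classical in
lemma greenFun_sub_markovOp (x : V) (n : ℕ) :
    ⇑(G.greenFun x n) - G.markovOp (G.greenFun x n) =
      Pi.single x 1 - (G.markovOp ^ n) (Pi.single x 1) := by
  rw [coe_greenFun, map_sum, ← Finset.sum_sub_distrib]
  simp only [← Module.End.mul_apply, ← pow_succ']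
  rw [Finset.sum_range_sub' fun k => (G.markovOp ^ k) (Pi.single x (1 : ℝ))]
  simp

/-- In Green's formula the term -P^n δ_x contributes at most 0 because π and g are nonnegative; only
δ_x remains. -/
lemma energy_greenFun_le (x : V) (n : ℕ) :
    G.energy (G.greenFun x n) (G.greenFun x n) ≤ G.totalWeight x * G.greenFun x n x := by
  classical
  rw [energy_eq_sum]
  set g := G.greenFun x n with hg
  have hle : ∀ y, g y - G.markovOp g y ≤ (Pi.single x 1 : V → ℝ) y := fun y => by
    have h := congrFun (G.greenFun_sub_markovOp x n) y
    simp only [Pi.sub_apply] at h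
    rw [h]
    exact sub_le_self _ (G.markovOp_pow_nonneg (single_nonneg x) n y)
  calc ∑ y ∈ g.support, G.totalWeight y * g y * (g y - G.markovOp g y)
      ≤ ∑ y ∈ g.support, G.totalWeight y * g y * (Pi.single x 1 : V → ℝ) y :=
        Finset.sum_le_sum fun y _ => mul_le_mul_of_nonneg_left (hle y)
          (mul_nonneg (G.totalWeight_nonneg y) (G.greenFun_nonneg x n y))
    _ ≤ G.totalWeight x * g x := by
        simp only [Pi.single_apply, mul_ite, mul_one, mul_zero, Finset.sum_ite_eq']
        split_ifs
        · exact le_rfl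
        · exact mul_nonneg (G.totalWeight_nonneg x) (G.greenFun_nonneg x n x)

/-! ### The walk killed at its return -/

open Classical in
/-- The transition operator of the walk killed when it steps to `x`. -/
def tabooOp (x : V) (f : V → ℝ) : V → ℝ := G.markovOp (Function.update f x 0)

lemma tabooOp_nonneg (x : V) {f : V → ℝ} (hf : 0 ≤ f) : 0 ≤ G.tabooOp x f := by
  classical
  refine G.markovOp_nonneg fun y => ?_
  by_cases h : y = x
  · simp [h]
  · simpa [h] using hf y

open Classical in
lemma tabooOp_eq (x : V) (f : V → ℝ) :
    G.tabooOp x f = G.markovOp f - f x • G.markovOp (Pi.single x 1) := by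
  rw [tabooOp, ← map_smul, ← map_sub]
  congr 1
  ext y
  by_cases h : y = x
  · subst h; simp
  · simp [h]

/-- The probability that the walk started at `x` does not return up to time `n`. -/
def survival (x : V) (n : ℕ) : ℝ := (G.tabooOp x)^[n] 1 x

lemma tabooOp_iterate_nonneg (x : V) (n : ℕ) : 0 ≤ (G.tabooOp x)^[n] 1 := by
  induction n with
  | zero => exact zero_le_one
  | succ n ih =>
    rw [Function.iterate_succ_apply']
    exact G.tabooOp_nonneg x ih

lemma survival_nonneg (x : V) (n : ℕ) : 0 ≤ G.survival x n := G.tabooOp_iterate_nonneg x n x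

-- Write Q for the killed operator, so that s_n = Q^n 1(x). From any start, paths either avoid `x`
-- at times 1, …, n or have a last visit at some time k, followed by n - k steps without return.
-- Starting at `x`, the case k = 0 is counted twice, which explains the extra term on the right. For
-- the induction, P is applied to the identity: the term s_n P δ_x is exactly the correction in
-- `tabooOp_eq`.
open Classical in
lemma tabooOp_iterate_add (x : V) (n : ℕ) :
    (G.tabooOp x)^[n] 1 + ∑ p ∈ antidiagonal n, G.survival x p.2 •
      (G.markovOp ^ p.1) (Pi.single x 1) = 1 + G.survival x n • Pi.single x 1 := by
  induction n with
  | zero => simp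
  | succ n ih =>
    have h := congrArg G.markovOp ih
    simp only [map_add, map_sum, map_smul, ← Module.End.mul_apply, ← pow_succ',
      markovOp_one] at h
    rw [Finset.Nat.sum_antidiagonal_succ, Function.iterate_succ_apply', tabooOp_eq]
    simp only [pow_zero, Module.End.one_apply]
    change _ - G.survival x n • _ + _ = _
    linear_combination (exp := 1) h

/-- Decomposition at the last visit to `x` before time `n`. -/
lemma sum_survival_mul (x : V) (n : ℕ) :
    (open Classical in
    ∑ p ∈ antidiagonal n, (G.markovOp ^ p.1) (Pi.single x 1) x * G.survival x p.2) = 1 := by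
  classical
  have h := congrFun (G.tabooOp_iterate_add x n) x
  simp only [Pi.add_apply, Finset.sum_apply, Pi.smul_apply, smul_eq_mul, Pi.one_apply,
    Pi.single_eq_same, mul_one] at h
  change G.survival x n + _ = _ at h
  simp only [mul_comm (G.survival x _)] at h
  linarith

/-- The last-visit identities for i < n sum over the triangle p.1 + p.2 < n, which lies in the
square expanded on the right; all terms are nonnegative. -/
lemma le_greenFun_mul_sum_survival (x : V) (n : ℕ) :
    (n : ℝ) ≤ G.greenFun x n x * ∑ k ∈ range n, G.survival x k := by
  classical
  rw [coe_greenFun, Finset.sum_apply, Finset.sum_mul_sum, ← Finset.sum_product']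
  calc (n : ℝ) = ∑ i ∈ range n, ∑ p ∈ antidiagonal i,
        (G.markovOp ^ p.1) (Pi.single x 1) x * G.survival x p.2 := by
        simp [sum_survival_mul]
    _ = ∑ p ∈ (range n).biUnion (antidiagonal ·),
        (G.markovOp ^ p.1) (Pi.single x 1) x * G.survival x p.2 := by
        rw [Finset.sum_biUnion]
        intro i _ j _ hij
        exact Finset.disjoint_left.2 fun p hp hq =>
          hij ((HasAntidiagonal.mem_antidiagonal.1 hp).symm.trans
            (HasAntidiagonal.mem_antidiagonal.1 hq))
    _ ≤ _ := by
        refine Finset.sum_le_sum_of_subset_of_nonneg (fun p hp => ?_) fun p _ _ =>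
          mul_nonneg (G.markovOp_pow_nonneg (single_nonneg x) _ x) (G.survival_nonneg x _)
        simp only [mem_biUnion, mem_range, HasAntidiagonal.mem_antidiagonal,
          mem_product] at hp ⊢
        obtain ⟨i, hi, h⟩ := hp
        omega

/-! ### The path measure -/

lemma stepPMF_apply (x y : V) : G.stepPMF x y = ENNReal.ofReal (G.transProb x y) := rfl

section Walk

variable [MeasurableSpace V] [DiscreteMeasurableSpace V]

lemma stepKernel_eq_sum (x : V) : G.stepKernel x =
    ∑ y ∈ G.stepSet x, ENNReal.ofReal (G.transProb x y) • Measure.dirac y := by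
  classical
  ext s hs
  change (G.stepPMF x).toMeasure s = _
  rw [PMF.toMeasure_apply _ hs, tsum_eq_sum (s := G.stepSet x)]
  · simp only [Measure.finsetSum_apply, Measure.smul_apply, smul_eq_mul]
    refine Finset.sum_congr rfl fun y _ => ?_
    rw [Measure.dirac_apply' _ hs]
    by_cases hy : y ∈ s <;> simp [hy, stepPMF_apply]
  · intro y hy
    by_cases hs : y ∈ s <;> simp [hs, stepPMF_apply, G.transProb_eq_zero hy]

lemma lintegral_stepKernel {f : V → ℝ} (hf : 0 ≤ f) (x : V) :
    ∫⁻ y, ENNReal.ofReal (f y) ∂(G.stepKernel x) = ENNReal.ofReal (G.markovOp f x) := by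
  rw [stepKernel_eq_sum, lintegral_finsetSum_measure, markovOp_apply,
    ENNReal.ofReal_sum_of_nonneg fun y _ => mul_nonneg (G.transProb_nonneg x y) (hf y)]
  refine Finset.sum_congr rfl fun y _ => ?_
  rw [lintegral_smul_measure, lintegral_dirac' _ Measurable.of_discrete, smul_eq_mul,
    ENNReal.ofReal_mul (G.transProb_nonneg x y)]

instance (x : V) : IsProbabilityMeasure (G.walkLaw x) := by
  unfold walkLaw; infer_instance

/-- The Markov property at time `n`. -/
lemma lintegral_walkLaw_succ (x : V) (n : ℕ) {F : (Finset.Iic n → V) → ℝ≥0∞} (hF : Measurable F)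
    {f : V → ℝ} (hf : 0 ≤ f) :
    ∫⁻ ω, F (Preorder.frestrictLe n ω) * ENNReal.ofReal (f (ω (n + 1))) ∂(G.walkLaw x) =
      ∫⁻ ω, F (Preorder.frestrictLe n ω) * ENNReal.ofReal (G.markovOp f (ω n))
        ∂(G.walkLaw x) := by
  have h := Kernel.partialTraj_compProd_eq_map_traj (X := fun _ => V) (κ := G.historyKernel)
    (Nat.zero_le n) (x₀ := fun _ => x)
  have hm1 : Measurable fun p : (Finset.Iic n → V) × V => F p.1 * ENNReal.ofReal (f p.2) :=
    (hF.comp measurable_fst).mul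
      ((Measurable.of_discrete (f := fun v => ENNReal.ofReal (f v))).comp measurable_snd)
  have hm2 : Measurable fun p : Finset.Iic n → V => F p *
      ENNReal.ofReal (G.markovOp f (p ⟨n, Finset.mem_Iic.2 le_rfl⟩)) :=
    hF.mul ((Measurable.of_discrete (f := fun v => ENNReal.ofReal (G.markovOp f v))).comp
      (measurable_pi_apply _))
  calc _ = ∫⁻ p, F p.1 * ENNReal.ofReal (f p.2)
        ∂((G.walkLaw x).map fun ω => (Preorder.frestrictLe n ω, ω (n + 1))) := by
        rw [lintegral_map hm1 (by fun_prop)]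
    _ = ∫⁻ p, F p * ENNReal.ofReal (G.markovOp f (p ⟨n, Finset.mem_Iic.2 le_rfl⟩))
        ∂((G.walkLaw x).map (Preorder.frestrictLe n)) := by
        -- The joint law of past and next position is a composition product, so the next position is
        -- integrated out first.
        rw [walkLaw, ← h, Measure.lintegral_compProd hm1, Kernel.traj_map_frestrictLe_apply]
        refine lintegral_congr fun p => ?_
        dsimp only
        rw [lintegral_const_mul _ Measurable.of_discrete, ← G.lintegral_stepKernel hf]
        rfl
    _ = _ := by rw [lintegral_map hm2 (by fun_prop)]; rfl

lemma lintegral_walkLaw_zero (x : V) (f : V → ℝ≥0∞) :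
    ∫⁻ ω, f (ω 0) ∂(G.walkLaw x) = f x := by
  have hm : Measurable fun p : Finset.Iic 0 → V => f (p ⟨0, Finset.mem_Iic.2 le_rfl⟩) :=
    (Measurable.of_discrete (f := f)).comp (measurable_pi_apply _)
  calc _ = ∫⁻ p, f (p ⟨0, Finset.mem_Iic.2 le_rfl⟩)
        ∂((G.walkLaw x).map (Preorder.frestrictLe 0)) := by
        rw [lintegral_map hm (by fun_prop)]; rfl
    _ = _ := by
        rw [walkLaw, Kernel.traj_map_frestrictLe_apply, Kernel.partialTraj_self, Kernel.id_apply,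
          lintegral_dirac' _ hm]

/-- The paths that do not visit `x` at the times `1, …, n`. -/
def noReturn (x : V) (n : ℕ) : Set (ℕ → V) := {ω | ∀ k, 1 ≤ k → k ≤ n → ω k ≠ x}

lemma measurableSet_eval_ne {ι : Type*} (x : V) (k : ι) :
    MeasurableSet {ω : ι → V | ω k ≠ x} :=
  (measurable_pi_apply (X := fun _ : ι => V) k)
    (MeasurableSet.of_discrete : MeasurableSet ({x}ᶜ : Set V))

lemma measurableSet_noReturn (x : V) (n : ℕ) : MeasurableSet (noReturn x n) := by
  simp only [noReturn, Set.ofPred_forall]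
  exact MeasurableSet.iInter fun k => MeasurableSet.iInter fun _ => MeasurableSet.iInter fun _ =>
    measurableSet_eval_ne x k

/-- The Markov property at the last step trades f, set to 0 at `x`, for Q f one step earlier; hence
the induction must vary f. -/
lemma lintegral_noReturn (x : V) (n : ℕ) {f : V → ℝ} (hf : 0 ≤ f) :
    ∫⁻ ω, (noReturn x n).indicator 1 ω * ENNReal.ofReal (f (ω n)) ∂(G.walkLaw x) =
      ENNReal.ofReal ((G.tabooOp x)^[n] f x) := by
  classical
  induction n generalizing f with
  | zero =>
    rw [Function.iterate_zero_apply, ← G.lintegral_walkLaw_zero x fun v => ENNReal.ofReal (f v)]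
    refine lintegral_congr fun ω => ?_
    rw [Set.indicator_of_mem]
    · simp
    · intro k h1 h2
      omega
  | succ n ih =>
    rw [Function.iterate_succ_apply, ← ih (G.tabooOp_nonneg x hf)]
    have hu : (0 : V → ℝ) ≤ Function.update f x 0 := fun y => by
      by_cases h : y = x
      · simp [h]
      · simpa [h] using hf y
    -- The event `noReturn x n`, seen as an event of the history up to time n.
    let A : Set (Finset.Iic n → V) := {p | ∀ k : Finset.Iic n, 1 ≤ (k : ℕ) → p k ≠ x}
    have hA : MeasurableSet A := by
      simp only [A, Set.ofPred_forall]
      exact MeasurableSet.iInter fun k => MeasurableSet.iInter fun _ =>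
        measurableSet_eval_ne x k
    have hAn : ∀ ω : ℕ → V, A.indicator (1 : (Finset.Iic n → V) → ℝ≥0∞) (Preorder.frestrictLe n ω) =
        (noReturn x n).indicator 1 ω := fun ω => by
      have : Preorder.frestrictLe (π := fun _ => V) n ω ∈ A ↔ ω ∈ noReturn x n :=
        ⟨fun h k h1 h2 => h ⟨k, Finset.mem_Iic.2 h2⟩ h1,
          fun h k h1 => h k h1 (Finset.mem_Iic.1 k.2)⟩
      simp only [Set.indicator_apply, this, Pi.one_apply]
    have h := G.lintegral_walkLaw_succ x n (F := A.indicator 1) (measurable_one.indicator hA) hu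
    simp only [hAn] at h
    refine Eq.trans (lintegral_congr fun ω => ?_) h
    have hiff : ω ∈ noReturn x (n + 1) ↔ ω ∈ noReturn x n ∧ ω (n + 1) ≠ x := by
      refine ⟨fun h => ⟨fun k h1 h2 => h k h1 (by omega), h _ (by omega) le_rfl⟩,
        fun h k h1 h2 => ?_⟩
      rcases Nat.lt_or_ge n k with hk | hk
      · obtain rfl : k = n + 1 := by omega
        exact h.2
      · exact h.1 k h1 hk
    by_cases h1 : ω (n + 1) = x
    · simp [Set.indicator_apply, hiff, h1]
    · simp [Set.indicator_apply, hiff, h1]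

lemma walkLaw_noReturn (x : V) (n : ℕ) :
    G.walkLaw x (noReturn x n) = ENNReal.ofReal (G.survival x n) := by
  rw [survival, ← G.lintegral_noReturn x n (f := 1) zero_le_one,
    ← lintegral_indicator_one (measurableSet_noReturn x n)]
  simp

/-- Continuity from above: the decreasing events `noReturn x n` intersect in a null set. -/
lemma tendsto_survival {x : V} (h : ∀ᵐ ω ∂(G.walkLaw x), ∃ n : ℕ, 1 ≤ n ∧ ω n = x) :
    Tendsto (G.survival x) atTop (𝓝 0) := by
  have h0 : G.walkLaw x (⋂ n, noReturn x n) = 0 := by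
    refine measure_mono_null (fun ω hω => ?_) h
    rintro ⟨n, h1, h2⟩
    exact Set.mem_iInter.1 hω n n h1 le_rfl h2
  have ht := tendsto_measure_iInter_atTop (μ := G.walkLaw x) (s := noReturn x)
    (fun n => (measurableSet_noReturn x n).nullMeasurableSet)
    (fun a b hab ω hω k h1 h2 => hω k h1 (h2.trans hab)) ⟨0, measure_ne_top _ _⟩
  rw [h0] at ht
  have := (ENNReal.tendsto_toReal ENNReal.zero_ne_top).comp ht
  refine this.congr fun n => ?_
  simp [walkLaw_noReturn, ENNReal.toReal_ofReal (G.survival_nonneg x n)]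

end Walk

/-! ### The bottom of the spectrum -/

lemma bottomOfSpectrum_nonneg : 0 ≤ G.bottomOfSpectrum := by
  refine le_iInf₂ fun H hH => ?_
  have : Nontrivial H := Module.nontrivial_of_finrank_pos (R := ℝ) (by omega)
  obtain ⟨f, hf⟩ := exists_ne (0 : H)
  refine le_iSup_of_le (f : V →₀ ℝ) (le_iSup_of_le f.2 (le_iSup_of_le (by simpa using hf) ?_))
  exact EReal.coe_nonneg.2 (div_nonneg (G.energy_nonneg _) (G.normSq_nonneg _))

/-- The Rayleigh quotient is constant on the nonzero vectors of a line. -/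
lemma bottomOfSpectrum_le {f : V →₀ ℝ} (hf : f ≠ 0) :
    G.bottomOfSpectrum ≤ ((G.energy f f / G.normSq f : ℝ) : EReal) := by
  refine iInf₂_le_of_le (Submodule.span ℝ {f}) (finrank_span_singleton hf) ?_
  refine iSup_le fun g => iSup₂_le fun hg hg0 => ?_
  obtain ⟨c, rfl⟩ := Submodule.mem_span_singleton.1 hg
  have hc : c ≠ 0 := by
    rintro rfl
    exact hg0 (zero_smul _ _)
  rw [Finsupp.coe_smul, energy_smul, normSq_smul, mul_div_mul_left _ _ (pow_ne_zero 2 hc)]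

lemma bottomOfSpectrum_le_survival (x : V) {n : ℕ} (hn : n ≠ 0) :
    G.bottomOfSpectrum ≤ ((G.totalWeight x / G.m x *
      ((n : ℝ)⁻¹ * ∑ k ∈ range n, G.survival x k) : ℝ) : EReal) := by
  set g := G.greenFun x n with hg
  set s := ∑ k ∈ range n, G.survival x k
  have hn' : (0 : ℝ) < n := by positivity
  have hmul : (n : ℝ) ≤ g x * s := G.le_greenFun_mul_sum_survival x n
  have hgx : 0 < g x := by
    refine (G.greenFun_nonneg x n x).lt_of_ne fun h => ?_
    rw [← hg] at h
    rw [← h, zero_mul] at hmul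
    linarith
  have hm := G.m_pos x
  have hg0 : g ≠ 0 := fun h => by simp [h] at hgx
  refine (G.bottomOfSpectrum_le hg0).trans (EReal.coe_le_coe_iff.2 ?_)
  calc G.energy g g / G.normSq g
      ≤ (G.totalWeight x * g x) / (g x ^ 2 * G.m x) :=
        div_le_div₀ (mul_nonneg (G.totalWeight_nonneg x) hgx.le) (G.energy_greenFun_le x n)
          (by positivity) (G.sq_mul_le_normSq g x)
    _ = G.totalWeight x / G.m x * (g x)⁻¹ := by field_simp
    _ ≤ _ := by
        refine mul_le_mul_of_nonneg_left ?_ (div_nonneg (G.totalWeight_nonneg x) hm.le)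
        rw [inv_mul_eq_div, le_div_iff₀ hn', inv_mul_le_iff₀ hgx]
        exact hmul

end WeightedGraph

end

theorem mainTheorem10 {V : Type*} [Infinite V] (G : WeightedGraph V) (hG : G.IsRecurrent) :
    G.bottomOfSpectrum = 0 := by
  refine le_antisymm ?_ G.bottomOfSpectrum_nonneg
  obtain ⟨x⟩ : Nonempty V := inferInstance
  let _ : MeasurableSpace V := ⊤
  have _ : DiscreteMeasurableSpace V := ⟨fun _ => trivial⟩
  -- The Cesàro means of a null sequence tend to 0, and the prefactor does not depend on n.
  have ht := ((G.tendsto_survival (hG x)).cesaro).const_mul (G.totalWeight x / G.m x)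
  rw [mul_zero] at ht
  refine ge_of_tendsto ((continuous_coe_real_ereal.tendsto 0).comp ht) ?_
  filter_upwards [Filter.eventually_ne_atTop 0] with n hn
  exact G.bottomOfSpectrum_le_survival x hn
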